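/- Let $\Gamma$ be a countably infinite discrete group acting continuously on a compact metrizable space $X$, and assume that $\Gamma$ is amenable: for every nonempty finite $K\subseteq\Gamma$ and every $\varepsilon>0$ there is a nonempty finite $F\subseteq\Gamma$ with $|KF\,\Delta\,F|<\varepsilon|F|$. Let $\mathcal M(X)$ be the space of Borel probability measures on $X$, viewed as a compact metrizable convex subset of the dual $C(X)^*$ of the space $C(X)$ of real continuous functions on $X$, with the weak$^*$ topology; $\Gamma$ acts on $\mathcal M(X)$ by push-forward, and $X$ is viewed as a subset of $\mathcal M(X)$ via $x\mapsto\delta_x$. *Measure IE-tuples.* Let $\Gamma$ act continuously on a compact metrizable space $Y$, let $\lambda$ be a $\Gamma$-invariant Borel probability measure on $Y$, and let $k\ge 1$ be an integer. Let $\mathbf A=(A_1,\dots,A_k)$ be a tuple of subsets of $Y$ and $D\subseteq Y$. A finite set $J\subseteq\Gamma$ is an independence set for $\mathbf A$ relative to $D$ if $D\cap\bigcap_{s\in J}s^{-1}A_{\sigma(s)}\neq\emptyset$ for every map $\sigma:J\to\{1,\dots,k\}$. For $\delta>0$ and a nonempty finite $F\subseteq\Gamma$ put $$\varphi_{\mathbf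 A,\lambda,\delta}(F)=\min_{D}\ \max\{|J| : J\subseteq F \text{ is an independence set for } \mathbf A \text{ relative to } D\},$$ where $D$ ranges over the Borel subsets of $Y$ with $\lambda(D)\ge 1-\delta$, and the maximum over an empty family is $0$. Let $\overline{\mathrm I}_\lambda(\mathbf A,\delta)$ be the limit supremum of $\varphi_{\mathbf A,\lambda,\delta}(F)/|F|$ as $F$ becomes more and more left invariant, that is, the smallest $t\in\mathbb R$ such that for every $\eta>0$ there are a nonempty finite $K\subseteq\Gamma$ and $\varepsilon>0$ such that $\varphi_{\mathbf A,\lambda,\delta}(F)/|F|<t+\eta$ for every nonempty finite $F\subseteq\Gamma$ with $|KF\,\Delta\,F|<\varepsilon|F|$. Put $\overline{\mathrm I}_\lambda(\mathbf A)=\sup_{\delta>0}\overline{\mathrm I}_\lambda(\mathbf A,\delta)$. Let $\mathrm{IE}^\lambda_k(Y)$ be the set of all $(y_1,\dots,y_k)\in Y^k$ such that $\overline{\mathrm I}_\lambda(U_1,\dots,U_k)>0$ whenever each $U_j$ is a neighborhood of $y_j$. **Theorem.** Let $m$ be a $\Gamma$-invariant Borel probability measure on $\mathcal M(X)$ and let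 $\mu\in\mathcal M(X)$ be its barycenter, i.e. $\int_{\mathcal M(X)}\phi(\nu)\,dm(\nu)=\phi(\mu)$ for every continuous linear functional $\phi$ on $C(X)^*$ (then $\mu$ is $\Gamma$-invariant). For every integer $k\ge1$: 1. $\mathrm{IE}^m_k(\mathcal M(X))$ is contained in the closed convex hull of $\mathrm{IE}^\mu_k(X)$ in $\mathcal M(X)^k$, where $\mathrm{IE}^\mu_k(X)\subseteq X^k\subseteq\mathcal M(X)^k$. 2. $\mathrm{IE}^m_k(\mathcal M(X))\cap X^k\subseteq\mathrm{IE}^\mu_k(X)$. -/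

import Mathlib

open MeasureTheory Topology

namespace MeasureIE

/-! ### Amenability and limits along left invariant finite sets -/

section Amenable

open scoped Pointwise symmDiff

variable {Γ : Type*} [Group Γ]

open Classical in
/-- The finite set `F` is nonempty and `(K, ε)`-invariant from the left: `|KF Δ F| < ε |F|`. -/
def IsInvariant (K : Finset Γ) (ε : ℝ) (F : Finset Γ) : Prop :=
  F.Nonempty ∧ (((K * F) ∆ F).card : ℝ) < ε * F.card

variable (Γ) in
/-- Amenability of a discrete group (the Følner condition): for every nonempty finite `K` and
every `ε > 0` there is a nonempty finite `F` with `|KF Δ F| < ε |F|`. -/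
def IsAmenable : Prop :=
  ∀ K : Finset Γ, K.Nonempty → ∀ ε : ℝ, 0 < ε → ∃ F : Finset Γ, IsInvariant K ε F

/-- The limit supremum of `φ F` as the nonempty finite set `F` becomes more and more left
invariant: the smallest real `t` such that for every `δ > 0` there are a nonempty finite `K` and
`ε > 0` with `φ F < t + δ` for all `(K, ε)`-invariant `F`. -/
noncomputable def limsupInvariant (φ : Finset Γ → ℝ) : ℝ :=
  sInf {t : ℝ | ∀ δ : ℝ, 0 < δ → ∃ K : Finset Γ, K.Nonempty ∧ ∃ ε : ℝ, 0 < ε ∧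
    ∀ F : Finset Γ, IsInvariant K ε F → φ F < t + δ}

end Amenable

/-! ### Measure IE-tuples -/

section IETuples

variable {Γ X : Type*} [Group Γ] [MulAction Γ X] {k : ℕ}

/-- The finite set `J ⊆ Γ` is an independence set for the tuple `A` of subsets of `X` relative to
`D`: `D ∩ ⋂ s ∈ J, s⁻¹ A_{σ(s)}` is nonempty for every map `σ` from `J` to the indices. -/
def IsIndependenceSet (A : Fin k → Set X) (D : Set X) (J : Finset Γ) : Prop :=
  ∀ σ : J → Fin k, (D ∩ ⋂ s : J, (fun x : X => (s : Γ) • x) ⁻¹' A (σ s)).Nonempty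

open Classical in
/-- The largest cardinality of a subset of `F` which is an independence set for `A` relative to
`D` (and `0` if there is none). -/
noncomputable def maxIndependent (A : Fin k → Set X) (D : Set X) (F : Finset Γ) : ℕ :=
  (F.powerset.filter fun J => IsIndependenceSet A D J).sup Finset.card

variable [MeasurableSpace X]

/-- The minimum of `maxIndependent A D F` over all Borel sets `D` with `μ(D) ≥ 1 - δ`. -/
noncomputable def minMaxIndependent (A : Fin k → Set X) (μ : ProbabilityMeasure X) (δ : ℝ)
    (F : Finset Γ) : ℕ :=
  sInf {n : ℕ | ∃ D : Set X, MeasurableSet D ∧ 1 - δ ≤ (μ : Measure X).real D ∧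
    maxIndependent A D F = n}

variable (Γ) in
/-- The limit supremum of `|F|⁻¹ φ_{A, μ, δ}(F)` as `F` becomes more and more left invariant,
where `φ_{A, μ, δ}` is `minMaxIndependent A μ δ`. -/
noncomputable def upperIndDensityAt (A : Fin k → Set X) (μ : ProbabilityMeasure X) (δ : ℝ) : ℝ :=
  limsupInvariant fun F : Finset Γ => (minMaxIndependent A μ δ F : ℝ) / (F.card : ℝ)

variable (Γ) in
/-- The upper `μ`-independence density of the tuple `A`, the supremum over all `δ > 0` of the
densities at `δ` (these all lie in `[0, 1]` when `Γ` is amenable). -/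
noncomputable def upperIndDensity (A : Fin k → Set X) (μ : ProbabilityMeasure X) : ℝ :=
  ⨆ δ : {δ : ℝ // 0 < δ}, upperIndDensityAt Γ A μ δ

variable (Γ) in
/-- The set of `μ`-IE-tuples of length `k`: tuples `x` such that for every product neighbourhood
`U_1 × ⋯ × U_k` of `x` the tuple `U` has positive upper `μ`-independence density. -/
def measureIE [TopologicalSpace X] (k : ℕ) (μ : ProbabilityMeasure X) : Set (Fin k → X) :=
  {x | ∀ U : Fin k → Set X, (∀ j, U j ∈ 𝓝 (x j)) → 0 < upperIndDensity Γ U μ}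

end IETuples

/-! ### The space of Borel probability measures

`ProbabilityMeasure X` carries the weak topology. Mathlib's σ-algebra on it is the one generated
by the evaluations `μ ↦ μ D`; for compact metrizable `X` it is the Borel σ-algebra of the weak
topology, as shown next. -/

section Borel

variable {X : Type*} [TopologicalSpace X] [MeasurableSpace X] [BorelSpace X]

theorem topology_eq_generateFrom : (inferInstance : TopologicalSpace (ProbabilityMeasure X)) =
    .generateFrom (⋃ f : BoundedContinuousFunction X NNReal,
      {s | ∃ V : Set NNReal, IsOpen V ∧
        (fun μ : ProbabilityMeasure X => μ.toFiniteMeasure.testAgainstNN f) ⁻¹' V = s}) := by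
  have h : (inferInstance : TopologicalSpace (ProbabilityMeasure X)) =
      ⨅ f : BoundedContinuousFunction X NNReal, TopologicalSpace.induced
        (fun μ : ProbabilityMeasure X => μ.toFiniteMeasure.testAgainstNN f) inferInstance := by
    have : (inferInstance : TopologicalSpace (ProbabilityMeasure X)) =
      TopologicalSpace.induced (fun (μ : ProbabilityMeasure X)
        (f : BoundedContinuousFunction X NNReal) => μ.toFiniteMeasure.testAgainstNN f)
        Pi.topologicalSpace :=
      (congrArg (TopologicalSpace.induced ProbabilityMeasure.toFiniteMeasure)
        (induced_compose (f := FiniteMeasure.toWeakDualBCNN) (tγ := Pi.topologicalSpace)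
          (g := fun (x : WeakDual NNReal (BoundedContinuousFunction X NNReal)) y => x y))).trans
        induced_compose
    rw [this, Pi.topologicalSpace, induced_iInf]
    simp_rw [induced_compose]
    rfl
  rw [generateFrom_iUnion, h]
  congr 1
  funext f
  exact (TopologicalSpace.generateFrom_setOfPred_isOpen
    (TopologicalSpace.induced (fun μ : ProbabilityMeasure X =>
      μ.toFiniteMeasure.testAgainstNN f) inferInstance)).symm

/-- The σ-algebra of `ProbabilityMeasure X` is the Borel σ-algebra of the weak topology. -/
instance instBorelSpaceProbabilityMeasure [CompactSpace X] [TopologicalSpace.MetrizableSpace X] :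
    BorelSpace (ProbabilityMeasure X) := by
  have := TopologicalSpace.pseudoMetrizableSpacePseudoMetric X
  refine ⟨le_antisymm ?_ ?_⟩
  · have hm : @Measurable _ _ (borel (ProbabilityMeasure X)) _
        (fun μ : ProbabilityMeasure X => (μ : Measure X)) := by
      let : MeasurableSpace (ProbabilityMeasure X) := borel _
      have : BorelSpace (ProbabilityMeasure X) := ⟨rfl⟩
      refine Measurable.measure_of_isPiSystem_of_isProbabilityMeasure
        (S := {s : Set X | IsClosed s})
        (by rw [← borel_eq_generateFrom_isClosed]; exact BorelSpace.measurable_eq)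
        (fun s hs t ht _ => IsClosed.inter hs ht) fun s hs => ?_
      refine measurable_of_tendsto_metrizable (f := fun n (μ : ProbabilityMeasure X) =>
        ∫⁻ x, (IsClosed.apprSeq hs n x : ENNReal) ∂(μ : Measure X)) (fun n => ?_) ?_
      · exact (ProbabilityMeasure.continuous_lintegral_boundedContinuousFunction _).measurable
      · rw [tendsto_pi_nhds]
        exact fun μ => HasOuterApproxClosed.tendsto_lintegral_apprSeq hs (μ : Measure X)
    exact hm.comap_le
  · rw [borel_eq_generateFrom_of_subbasis (topology_eq_generateFrom (X := X))]
    refine MeasurableSpace.generateFrom_le fun s hs => ?_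
    obtain ⟨f, V, hV, rfl⟩ := Set.mem_iUnion.1 hs
    refine Measurable.ennreal_toNNReal ?_ hV.measurableSet
    exact (Measure.measurable_lintegral
      (f.continuous.measurable.coe_nnreal_ennreal)).comp measurable_subtype_coe

end Borel

/-! ### The induced action on probability measures -/

section Action

variable {Γ X : Type*} [Group Γ] [MulAction Γ X] [MeasurableSpace X] [MeasurableConstSMul Γ X]

/-- The induced action of `Γ` on probability measures: `s • μ` is the push-forward of `μ` under
`x ↦ s • x`. -/
noncomputable instance instMulActionProbabilityMeasure : MulAction Γ (ProbabilityMeasure X) where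
  smul s μ := μ.map (measurable_const_smul s).aemeasurable
  one_smul μ := by
    apply Subtype.ext
    change Measure.map (fun x => (1 : Γ) • x) (μ : Measure X) = μ
    simp
  mul_smul s t μ := by
    apply Subtype.ext
    change Measure.map (fun x => (s * t) • x) (μ : Measure X) =
      Measure.map (fun x => s • x) (Measure.map (fun x => t • x) (μ : Measure X))
    rw [Measure.map_map (measurable_const_smul s) (measurable_const_smul t)]
    congr 1
    funext x
    exact mul_smul s t x

end Action

/-! ### Probability measures as functionals, barycenters -/

section Barycenter

variable {X : Type*} [TopologicalSpace X] [CompactSpace X] [MeasurableSpace X] [BorelSpace X]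

/-- The canonical map from the Borel probability measures on `X` to the dual of `C(X)` with its
weak* topology, sending `μ` to `f ↦ ∫ f dμ`. -/
noncomputable def toDual (μ : ProbabilityMeasure X) : WeakDual ℝ C(X, ℝ) :=
  StrongDual.toWeakDual <| LinearMap.mkContinuous
    { toFun := fun f => ∫ x, f x ∂(μ : Measure X)
      map_add' := fun f g => integral_add
        (f.continuous.integrable_of_hasCompactSupport (HasCompactSupport.of_compactSpace _))
        (g.continuous.integrable_of_hasCompactSupport (HasCompactSupport.of_compactSpace _))
      map_smul' := fun c f => integral_const_mul c fun x => f x }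
    1 (fun f => by
      simpa using norm_integral_le_of_norm_le_const (μ := (μ : Measure X))
        (Filter.Eventually.of_forall fun x => f.norm_coe_le_norm x))

/-- `μ` is the barycenter of the Borel probability measure `m` on the space of Borel probability
measures on `X`, the latter being viewed as a convex subset of the weak* dual of `C(X)`:
`∫ φ dm = φ(μ)` for every continuous linear functional `φ` on that dual. -/
def IsBarycenter (m : ProbabilityMeasure (ProbabilityMeasure X)) (μ : ProbabilityMeasure X) :
    Prop :=
  ∀ φ : WeakDual ℝ C(X, ℝ) →L[ℝ] ℝ,
    ∫ ν, φ (toDual ν) ∂(m : Measure (ProbabilityMeasure X)) = φ (toDual μ)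

end Barycenter

end MeasureIE

/-! By Hahn–Banach the first assertion reduces to `exists_mem_measureIE_le_sum`: for test functions
`f j` and an IE-tuple `ν` of measures, some IE-tuple `x` of points has `∑ f j (x j)` at least `∑ ∫ f
j ∂(ν j) - ε`. The second assertion follows from the same lemma applied to bump functions.

To find `x`, consider the half-spaces of measures `ν'` with `∫ f j ∂ν'` almost as large as `∫ f j
∂(ν j)`. They are neighbourhoods of the `ν j`, so they are independent along a set `J` of positive
density, relative to the measures giving mass at least `1 - η` to a large set `D`; Markov's
inequality for the barycenter makes these measures `m`-typical. For every word `σ` on `J`,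
integrating against a witnessing measure yields a point of `D` along whose orbit the sum of the `f
(σ s)` is large (`exists_mem_le_sum`). A finite colouring of `X` turns this orbit into a colour word
`τ σ`.

The combinatorial core is `exists_pattern`: some assignment `p` of colours to letters, itself nearly
as good as the average, is realised freely on a positive proportion of `J`, so the fibres of `p` are
independent. Otherwise, by a Sauer–Shelah argument, each good `p` is avoided according to one of
subexponentially many recipes. Once the recipes are fixed, the values allowed at each site have
negative mean over the letters, and a Chernoff bound leaves exponentially too few words `σ`.
Compactness then replaces fibres by points. -/

namespace MeasureIE

/-! ### Sauer–Shelah counting and the halving algorithm -/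

section Shattering

variable {J κ S : Type*} [Fintype J]

/-- `V` shatters `I` along `b : κ → S` if every word in `κ` on `I` is, after applying `b`, the
restriction of an element of `V`. -/
def Shatters (b : κ → S) (V : Set (J → S)) (I : Finset J) : Prop :=
  ∀ q : J → κ, ∃ v ∈ V, ∀ s ∈ I, v s = b (q s)

open Classical in
/-- The finite set of all sets shattered by `V` along `b`. -/
noncomputable def shattered (b : κ → S) (V : Set (J → S)) : Finset (Finset J) :=
  Finset.univ.filter (Shatters b V)

theorem mem_shattered {b : κ → S} {V : Set (J → S)} {I : Finset J} :
    I ∈ shattered b V ↔ Shatters b V I := by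
  simp [shattered]

theorem empty_mem_shattered [Nonempty κ] {b : κ → S} {V : Set (J → S)} (hV : V.Nonempty) :
    ∅ ∈ shattered b V := by
  obtain ⟨v, hv⟩ := hV
  exact mem_shattered.2 fun _ => ⟨v, hv, by simp⟩

/-- A set shattered by a subclass avoids `s`, because that subclass fixes the value at `s` and there
are at least two letters. Such a set is counted at most `card κ - 1` times unless all subclasses
shatter it. In that case inserting `s` gives a further set shattered by `V`, which pays for the
extra count. -/
theorem sum_card_shattered_le [Fintype κ] [Nontrivial κ] {b : κ → S} (hb : b.Injective)
    (V : Set (J → S)) (s : J) :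
    ∑ j, (shattered b {v ∈ V | v s = b j}).card ≤
      (Fintype.card κ - 1) * (shattered b V).card := by
  classical
  set W : κ → Set (J → S) := fun j => {v ∈ V | v s = b j}
  have hk : 1 < Fintype.card κ := Fintype.one_lt_card
  set A := (shattered b V).filter fun I => s ∉ I
  set B := A.filter fun I => insert s I ∈ shattered b V
  have hWA (j : κ) : shattered b (W j) ⊆ A := by
    intro I hI
    rw [mem_shattered] at hI
    refine Finset.mem_filter.2 ⟨mem_shattered.2 fun q => ?_, fun hs => ?_⟩
    · obtain ⟨v, hv, h⟩ := hI q
      exact ⟨v, hv.1, h⟩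
    · obtain ⟨j', hj'⟩ := exists_ne j
      obtain ⟨v, hv, h⟩ := hI fun _ => j'
      exact hj' (hb ((h s hs).symm.trans hv.2))
  have hB {I : Finset J} (hI : I ∈ A) (h : ∀ j, I ∈ shattered b (W j)) : I ∈ B := by
    refine Finset.mem_filter.2 ⟨hI, mem_shattered.2 fun q => ?_⟩
    obtain ⟨v, hv, hvq⟩ := mem_shattered.1 (h (q s)) q
    refine ⟨v, hv.1, fun t ht => ?_⟩
    rcases Finset.mem_insert.1 ht with rfl | ht
    · exact hv.2
    · exact hvq t ht
  have hcard : A.card + B.card ≤ (shattered b V).card := by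
    rw [← Finset.card_filter_add_card_filter_not (s := shattered b V) fun I => s ∉ I]
    refine Nat.add_le_add_left (Finset.card_le_card_of_injOn (insert s) ?_ ?_) _
    · intro I hI
      have := (Finset.mem_filter.1 hI).2
      exact Finset.mem_coe.2 (Finset.mem_filter.2 ⟨this, by simp⟩)
    · intro I hI I' hI' h
      have h1 := (Finset.mem_filter.1 (Finset.mem_filter.1 hI).1).2
      have h2 := (Finset.mem_filter.1 (Finset.mem_filter.1 hI').1).2
      rw [← Finset.erase_insert h1, ← Finset.erase_insert h2]
      exact congrArg (fun T => Finset.erase T s) h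
  calc ∑ j, (shattered b (W j)).card
      = ∑ j, ∑ I ∈ A, if I ∈ shattered b (W j) then 1 else 0 := by
        refine Finset.sum_congr rfl fun j _ => ?_
        rw [Finset.sum_boole, Nat.cast_id, Finset.filter_mem_eq_inter,
          Finset.inter_eq_right.2 (hWA j)]
    _ = ∑ I ∈ A, ∑ j, if I ∈ shattered b (W j) then 1 else 0 := Finset.sum_comm
    _ ≤ ∑ I ∈ A, ((Fintype.card κ - 1) + if I ∈ B then 1 else 0) := by
        refine Finset.sum_le_sum fun I hI => ?_
        rw [Finset.sum_boole, Nat.cast_id]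
        by_cases h : ∀ j, I ∈ shattered b (W j)
        · rw [if_pos (hB hI h)]
          refine (Finset.card_le_univ _).trans (by omega)
        · obtain ⟨j, hj⟩ := not_forall.1 h
          have : (Finset.univ.filter fun j => I ∈ shattered b (W j)).card <
              Fintype.card κ :=
            Finset.card_lt_univ_of_notMem (x := j) (by simpa using hj)
          omega
    _ = (Fintype.card κ - 1) * A.card + B.card := by
        rw [Finset.sum_add_distrib, Finset.sum_const, smul_eq_mul, mul_comm, Finset.sum_boole,
          Nat.cast_id, Finset.filter_mem_eq_inter,
          Finset.inter_eq_right.2 (Finset.filter_subset _ _)]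
    _ ≤ (Fintype.card κ - 1) * A.card + (Fintype.card κ - 1) * B.card := by
        gcongr
        exact Nat.le_mul_of_pos_left _ (by omega)
    _ ≤ (Fintype.card κ - 1) * (shattered b V).card := by
        rw [← mul_add]
        gcongr

theorem exists_card_shattered_le [Fintype κ] [Nontrivial κ] {b : κ → S} (hb : b.Injective)
    (V : Set (J → S)) (s : J) :
    ∃ j, ((shattered b {v ∈ V | v s = b j}).card : ℝ) ≤
      (((Fintype.card κ : ℝ) - 1) / Fintype.card κ) * (shattered b V).card := by
  have hk : 1 < Fintype.card κ := Fintype.one_lt_card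
  have h := sum_card_shattered_le hb V s
  have h' : ∑ j, ((shattered b {v ∈ V | v s = b j}).card : ℝ) ≤
      ∑ _j : κ, (((Fintype.card κ : ℝ) - 1) / Fintype.card κ) * (shattered b V).card := by
    rw [Finset.sum_const, Finset.card_univ, nsmul_eq_mul, ← mul_assoc, mul_div_cancel₀ _
      (by positivity)]
    have : ((∑ j, (shattered b {v ∈ V | v s = b j}).card : ℕ) : ℝ) ≤
      (((Fintype.card κ - 1) * (shattered b V).card : ℕ) : ℝ) := by exact_mod_cast h
    rw [Nat.cast_mul, Nat.cast_sub hk.le] at this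
    simpa using this
  obtain ⟨j, -, hj⟩ := Finset.exists_le_of_sum_le Finset.univ_nonempty h'
  exact ⟨j, hj⟩

/-- A class shattering few sets is avoided by few words: the words are decoded from the sets of
mistakes of the halving algorithm. -/
theorem exists_avoiding_words [Fintype κ] [Nontrivial κ] {b : κ → S} (hb : b.Injective)
    (T : Finset J) (V : Set (J → S)) (L : ℕ)
    (h : ((shattered b V).card : ℝ) * (((Fintype.card κ : ℝ) - 1) / Fintype.card κ) ^ L < 1) :
    ∃ dec : Finset J → J → κ, ∀ v ∈ V, ∃ M : Finset J, M ⊆ T ∧ M.card < L ∧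
      ∀ s ∈ T, v s ≠ b (dec M s) := by
  classical
  have hk : 1 < (Fintype.card κ : ℝ) := by exact_mod_cast Fintype.one_lt_card (α := κ)
  set r := ((Fintype.card κ : ℝ) - 1) / Fintype.card κ
  have hr : 0 ≤ r := div_nonneg (by linarith) (by linarith)
  obtain ⟨j₀⟩ := (inferInstance : Nonempty κ)
  induction T using Finset.induction_on generalizing V L with
  | empty =>
    refine ⟨fun _ _ => j₀, fun v hv => ⟨∅, subset_rfl, ?_, by simp⟩⟩
    rw [Finset.card_empty, Nat.pos_iff_ne_zero]
    rintro rfl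
    have : 0 < (shattered b V).card := Finset.card_pos.2 ⟨∅, empty_mem_shattered ⟨v, hv⟩⟩
    have : (1 : ℝ) ≤ (shattered b V).card := by exact_mod_cast this
    rw [pow_zero, mul_one] at h
    linarith
  | insert s T hs ih =>
    -- The letter `j` is the default guess for a letter avoided at `s`. A wrong guess, `v s = b j`,
    -- shrinks the number of shattered sets by the factor `(k - 1) / k`, so one unit of the budget
    -- `L` pays for it.
    obtain ⟨j, hj⟩ := exists_card_shattered_le hb V s
    obtain ⟨j', hj'⟩ := exists_ne j
    obtain ⟨dec₀, h₀⟩ := ih V L h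
    -- With no budget left, fewer than one set is shattered and the class is empty.
    rcases L with _ | L
    · refine ⟨fun _ _ => j₀, fun v hv => ?_⟩
      obtain ⟨M, -, hM, -⟩ := h₀ v hv
      omega
    obtain ⟨dec₁, h₁⟩ := ih {v ∈ V | v s = b j} L (by
      refine lt_of_le_of_lt (mul_le_mul_of_nonneg_right hj (pow_nonneg hr L)) ?_
      rw [pow_succ] at h
      linarith)
    -- Membership of `s` in `M` records a wrong guess at `s`; the decoder then uses `j' ≠ j` and
    -- continues with the smaller class.
    refine ⟨fun M => if s ∈ M then Function.update (dec₁ (M.erase s)) s j'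
      else Function.update (dec₀ M) s j, fun v hv => ?_⟩
    by_cases hvs : v s = b j
    · obtain ⟨M, hMT, hML, hM⟩ := h₁ v ⟨hv, hvs⟩
      have hsM : s ∉ M := fun h => hs (hMT h)
      refine ⟨insert s M, Finset.insert_subset_insert s hMT, ?_, fun t ht => ?_⟩
      · rw [Finset.card_insert_of_notMem hsM]
        omega
      · beta_reduce
        rw [if_pos (Finset.mem_insert_self s M), Finset.erase_insert hsM]
        rcases Finset.mem_insert.1 ht with rfl | ht
        · rw [Function.update_self, hvs]
          exact fun h => hj' (hb h).symm
        · rw [Function.update_of_ne (fun e : t = s => hs (e ▸ ht))]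
          exact hM t ht
    · obtain ⟨M, hMT, hML, hM⟩ := h₀ v hv
      have hsM : s ∉ M := fun h => hs (hMT h)
      refine ⟨M, hMT.trans (Finset.subset_insert s T), hML, fun t ht => ?_⟩
      beta_reduce
      rw [if_neg hsM]
      rcases Finset.mem_insert.1 ht with rfl | ht
      · rwa [Function.update_self]
      · rw [Function.update_of_ne (fun e : t = s => hs (e ▸ ht))]
        exact hM t ht

end Shattering

/-! ### Entropy bound for sets of small density -/

section Counting

/-- The sets of density at most `β` in an `n`-element set number at most `exp (h * n)` once `β`
is small. -/
theorem exists_card_small_sets_le {h : ℝ} (hh : 0 < h) :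
    ∃ β : ℝ, 0 < β ∧ ∀ (J : Type*) [Fintype J] (P : Finset (Finset J)),
      (∀ M ∈ P, (M.card : ℝ) ≤ β * Fintype.card J) →
      (P.card : ℝ) ≤ Real.exp (h * Fintype.card J) := by
  classical
  -- Weight each set `M` by `y ^ M.card`. The total weight `(1 + y) ^ n` is at most `exp (h / 2 *
  -- n)` since `y ≤ h / 2`, while for `β = h / 2 / (1 + 2 / h)` each set of density at most `β`
  -- weighs at least `exp (-(h / 2 * n))`.
  set y := Real.exp (-(1 + 2 / h)) 
  have hy0 : 0 < y := Real.exp_pos _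
  have hyh : y ≤ h / 2 := by
    have : y = (Real.exp (1 + 2 / h))⁻¹ := Real.exp_neg _
    rw [this]
    refine inv_le_of_inv_le₀ (by positivity) ?_
    rw [inv_div]
    have := Real.add_one_le_exp (1 + 2 / h)
    linarith
  have hpos : 0 < 1 + 2 / h := by positivity
  refine ⟨h / 2 / (1 + 2 / h), by positivity, fun J _ P hP => ?_⟩
  set n : ℝ := (Fintype.card J : ℝ)
  have hn : 0 ≤ n := Nat.cast_nonneg _
  have hlow : (P.card : ℝ) * Real.exp (-(h / 2 * n)) ≤ ∑ M : Finset J, y ^ M.card := by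
    calc (P.card : ℝ) * Real.exp (-(h / 2 * n)) = ∑ M ∈ P, Real.exp (-(h / 2 * n)) := by simp
      _ ≤ ∑ M ∈ P, y ^ M.card := by
        refine Finset.sum_le_sum fun M hM => ?_
        rw [← Real.exp_nat_mul, Real.exp_le_exp]
        have := mul_le_mul_of_nonneg_right (hP M hM) hpos.le
        have e : h / 2 / (1 + 2 / h) * n * (1 + 2 / h) = h / 2 * n := by field_simp
        rw [e] at this
        linarith
      _ ≤ ∑ M : Finset J, y ^ M.card :=
        Finset.sum_le_sum_of_subset_of_nonneg (Finset.subset_univ P) fun _ _ _ => by positivity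
  have hup : ∑ M : Finset J, y ^ M.card ≤ Real.exp (h / 2 * n) := by
    have e : ∑ M : Finset J, y ^ M.card = (y + 1) ^ Fintype.card J := by
      simpa using Fintype.sum_pow_mul_eq_add_pow J y 1
    rw [e, mul_comm, Real.exp_nat_mul]
    gcongr
    exact (Real.add_one_le_exp y).trans (Real.exp_le_exp.2 hyh)
  have := hlow.trans hup
  rw [Real.exp_neg, ← div_eq_mul_inv, div_le_iff₀ (Real.exp_pos _), ← Real.exp_add] at this
  rwa [show h / 2 * n + h / 2 * n = h * n by ring] at this

end Counting

/-! ### Free occurrence of a good pattern -/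

section Patterns

/-- A class which shatters no set of positive density is avoided by subexponentially many words. -/
theorem exists_shatters_or_avoiding_words (κ : Type*) [Fintype κ] [Nontrivial κ] {h : ℝ}
    (hh : 0 < h) :
    ∃ c : ℝ, 0 < c ∧ ∀ (J S : Type*) [Fintype J] (b : κ → S) (_ : b.Injective) (V : Set (J → S)),
      (∃ I : Finset J, c * Fintype.card J ≤ I.card ∧ Shatters b V I) ∨
      ∃ P : Finset (Finset J), (P.card : ℝ) ≤ Real.exp (h * Fintype.card J) ∧
        ∃ dec : Finset J → J → κ, ∀ v ∈ V, ∃ M ∈ P, ∀ s, v s ≠ b (dec M s) := by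
  classical
  have hk : 1 < (Fintype.card κ : ℝ) := by exact_mod_cast Fintype.one_lt_card (α := κ)
  set r := ((Fintype.card κ : ℝ) - 1) / Fintype.card κ with hrdef
  have hr0 : 0 < r := div_pos (by linarith) (by linarith)
  have hr1 : r < 1 := (div_lt_one (by linarith)).2 (by linarith)
  have hlog : Real.log r < 0 := Real.log_neg hr0 hr1
  obtain ⟨β, hβ, hβP⟩ := exists_card_small_sets_le hh
  -- This exponent bounds the number of shattered sets by `r ^ (-β n)`, which is beaten by `r ^ L`
  -- as soon as `L > β n`.
  obtain ⟨c, hc, hcP⟩ := exists_card_small_sets_le (h := β * -Real.log r)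
    (mul_pos hβ (by linarith))
  refine ⟨c, hc, fun J S _ b hb V => or_iff_not_imp_left.2 fun hV => ?_⟩
  push Not at hV
  have hn : (0 : ℝ) ≤ Fintype.card J := Nat.cast_nonneg _
  have hsh := hcP J (shattered b V) fun I hI =>
    le_of_not_gt fun hlt => hV I hlt.le (mem_shattered.1 hI)
  set L := ⌊β * Fintype.card J⌋₊ + 1
  obtain ⟨dec, hdec⟩ := exists_avoiding_words hb Finset.univ V L (by
    rw [← hrdef, ← Real.exp_log hr0, ← Real.exp_nat_mul]
    refine lt_of_le_of_lt (mul_le_mul_of_nonneg_right hsh (Real.exp_pos _).le) ?_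
    rw [← Real.exp_add, Real.exp_lt_one_iff]
    have hL : β * Fintype.card J < (L : ℝ) := by
      simpa [L] using Nat.lt_floor_add_one (β * (Fintype.card J : ℝ))
    nlinarith)
  refine ⟨Finset.univ.filter fun M => M.card < L, hβP J _ fun M hM => ?_, dec, fun v hv => ?_⟩
  · have : M.card ≤ ⌊β * Fintype.card J⌋₊ := Nat.lt_succ_iff.1 (Finset.mem_filter.1 hM).2
    exact (Nat.le_floor_iff (by positivity)).1 this
  · obtain ⟨M, -, hM, h⟩ := hdec v hv
    exact ⟨M, by simpa using hM, fun s => h s (Finset.mem_univ s)⟩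

/-- A Chernoff bound for sums of independent bounded variables with negative mean. -/
theorem card_filter_le_sum_le {J κ : Type*} [Fintype J] [DecidableEq J] [Fintype κ] [Nonempty κ]
    {H : J → κ → ℝ} {B ε l : ℝ} (hH : ∀ s j, |H s j| ≤ B) (hsum : ∀ s, ∑ j, H s j ≤ -ε)
    (hl : 0 < l) (hlB : l * B ≤ 1) (hlε : l * (Fintype.card κ * B ^ 2) ≤ ε / 2) :
    ((Finset.univ.filter fun σ : J → κ =>
      -(ε / (4 * Fintype.card κ) * Fintype.card J) ≤ ∑ s, H s (σ s)).card : ℝ) ≤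
    Fintype.card κ ^ Fintype.card J *
      Real.exp (-(l * ε / (4 * Fintype.card κ) * Fintype.card J)) := by
  set k : ℝ := (Fintype.card κ : ℝ)
  set n := Fintype.card J
  have hk : 0 < k := by simp [k, Fintype.card_pos]
  have hfac (s : J) : ∑ j, Real.exp (l * H s j) ≤ k * Real.exp (-(l * ε / (2 * k))) := by
    have h1 (j : κ) : Real.exp (l * H s j) ≤ 1 + l * H s j + l ^ 2 * B ^ 2 := by
      have hb : |l * H s j| ≤ 1 := by
        rw [abs_mul, abs_of_pos hl]
        exact (mul_le_mul_of_nonneg_left (hH s j) hl.le).trans hlB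
      have := (abs_le.1 (Real.abs_exp_sub_one_sub_id_le hb)).2
      have h2 : (H s j) ^ 2 ≤ B ^ 2 := sq_le_sq' (abs_le.1 (hH s j)).1 (abs_le.1 (hH s j)).2
      nlinarith [sq_nonneg l]
    calc ∑ j, Real.exp (l * H s j) ≤ ∑ j, (1 + l * H s j + l ^ 2 * B ^ 2) :=
          Finset.sum_le_sum fun j _ => h1 j
      _ = k + l * ∑ j, H s j + l * (l * (k * B ^ 2)) := by
          rw [Finset.sum_add_distrib, Finset.sum_add_distrib, ← Finset.mul_sum]
          simp only [Finset.sum_const, Finset.card_univ, nsmul_eq_mul, k]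
          ring
      _ ≤ k + l * (-ε) + l * (ε / 2) := by gcongr; exact hsum s
      _ = k * (-(l * ε / (2 * k)) + 1) := by field_simp; ring
      _ ≤ _ := by gcongr; exact Real.add_one_le_exp _
  set Q := Finset.univ.filter fun σ : J → κ => -(ε / (4 * k) * n) ≤ ∑ s, H s (σ s)
  have hlow : (Q.card : ℝ) * Real.exp (-(l * ε / (4 * k) * n)) ≤
      ∑ σ : J → κ, ∏ s, Real.exp (l * H s (σ s)) := by
    calc (Q.card : ℝ) * Real.exp (-(l * ε / (4 * k) * n))
        = ∑ σ ∈ Q, Real.exp (-(l * ε / (4 * k) * n)) := by simp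
      _ ≤ ∑ σ ∈ Q, ∏ s, Real.exp (l * H s (σ s)) := by
        refine Finset.sum_le_sum fun σ hσ => ?_
        rw [← Real.exp_sum, Real.exp_le_exp, ← Finset.mul_sum]
        have := mul_le_mul_of_nonneg_left (Finset.mem_filter.1 hσ).2 hl.le
        refine le_trans (le_of_eq ?_) this
        ring
      _ ≤ _ := Finset.sum_le_sum_of_subset_of_nonneg (Finset.subset_univ _)
        fun _ _ _ => by positivity
  have hup : ∑ σ : J → κ, ∏ s, Real.exp (l * H s (σ s)) ≤
      (k * Real.exp (-(l * ε / (2 * k)))) ^ n := by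
    rw [← Fintype.prod_sum fun s j => Real.exp (l * H s j)]
    refine (Finset.prod_le_prod (fun _ _ => by positivity) fun s _ => hfac s).trans ?_
    simp [n]
  have h := hlow.trans hup
  rw [Real.exp_neg, ← div_eq_mul_inv, div_le_iff₀ (Real.exp_pos _), mul_pow, ← Real.exp_nat_mul,
    mul_assoc, ← Real.exp_add] at h
  have e : n * -(l * ε / (2 * k)) + l * ε / (4 * k) * n = -(l * ε / (4 * k) * n) := by
    field_simp
    ring
  rwa [e] at h

/-- The proof counts words `σ`. If every good pattern fails, each `σ` is assigned a tuple of
recipes, one for each good pattern, naming at every site a pair (letter, colour) that `σ` and `τ σ`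
do not show there. There are few tuples, and each is shared by an exponentially small fraction of
the words. -/
theorem exists_pattern_of_nontrivial {κ ι : Type*} [Fintype κ] [Nontrivial κ] [Fintype ι]
    (v : κ → ι → ℝ) (a : κ → ℝ) {ε : ℝ} (hε : 0 < ε) :
    ∃ c : ℝ, 0 < c ∧ ∀ (J : Type*) [Fintype J] [Nonempty J]
      (τ : (J → κ) → J → ι),
      (∀ σ, -(ε / (4 * Fintype.card κ) * Fintype.card J) ≤ ∑ s, (v (σ s) (τ σ s) - a (σ s))) →
      ∃ p : κ → ι, ∑ j, a j - ε ≤ ∑ j, v j (p j) ∧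
        ∃ I : Finset J, c * Fintype.card J ≤ I.card ∧
          ∀ σ : J → κ, ∃ σ', ∀ s ∈ I, τ σ' s = p (σ s) := by
  classical
  obtain ⟨C, hC0, hC⟩ : ∃ C : ℝ, 0 ≤ C ∧ ∀ j i, |v j i - a j| ≤ C := by
    obtain ⟨C, hC⟩ := (Set.finite_range fun x : κ × ι => |v x.1 x.2 - a x.1|).bddAbove
    exact ⟨max C 0, le_max_right _ _, fun j i => (hC ⟨(j, i), rfl⟩).trans (le_max_left _ _)⟩
  set k : ℝ := (Fintype.card κ : ℝ) with hkdef
  have hk : 1 < k := Nat.one_lt_cast.2 Fintype.one_lt_card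
  -- A letter with no allowed colour is given the value `-B`; this is negative enough that one such
  -- letter brings the sum over letters down to `-ε`, the others contributing at most `k * C`.
  set B := k * C + ε with hB
  have hCB : C ≤ B := by nlinarith
  have hB0 : 0 < B := by positivity
  set l := min (1 / B) (ε / 2 / (k * B ^ 2))
  have hl : 0 < l := by positivity
  have hlB : l * B ≤ 1 := (le_div_iff₀ hB0).1 (min_le_left _ _)
  have hlε : l * (k * B ^ 2) ≤ ε / 2 := (le_div_iff₀ (by positivity)).1 (min_le_right _ _)
  set θ := l * ε / (4 * k)
  have hθ : 0 < θ := by positivity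
  let G := {p : κ → ι // ∑ j, a j - ε ≤ ∑ j, v j (p j)}
  -- Dividing by `Fintype.card G + 1` keeps the number of recipe tuples over all good patterns
  -- strictly below the Chernoff gain `exp (θ * n)`.
  obtain ⟨c, hc, hcP⟩ := exists_shatters_or_avoiding_words κ
    (h := θ / (Fintype.card G + 1)) (by positivity)
  refine ⟨c, hc, fun J _ _ τ hτ => ?_⟩
  set n := Fintype.card J
  have hn : 0 < n := Fintype.card_pos
  by_contra hcon
  push Not at hcon
  -- Pairing `τ σ` with `σ` itself makes `j ↦ (j, p j)` injective even when `p` is not.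
  let V : Set (J → κ × ι) := Set.range fun σ s => (σ s, τ σ s)
  have hP (p : G) : ∃ P : Finset (Finset J),
      (P.card : ℝ) ≤ Real.exp (θ / (Fintype.card G + 1) * n) ∧
      ∃ dec : Finset J → J → κ, ∀ σ : J → κ, ∃ M ∈ P,
        ∀ s, (σ s, τ σ s) ≠ (dec M s, p.1 (dec M s)) := by
    rcases hcP J (κ × ι) (fun j => (j, p.1 j)) (fun j j' h => (Prod.ext_iff.1 h).1) V with h | h
    · obtain ⟨I, hI, hsh⟩ := h
      obtain ⟨σ, hσ⟩ := hcon p.1 p.2 I hI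
      obtain ⟨_, ⟨σ', rfl⟩, hσ'⟩ := hsh σ
      obtain ⟨s, hs, hne⟩ := hσ σ'
      exact (hne (Prod.ext_iff.1 (hσ' s hs)).2).elim
    · obtain ⟨P, hPc, dec, hdec⟩ := h
      exact ⟨P, hPc, dec, fun σ => hdec _ ⟨σ, rfl⟩⟩
  choose P hPc dec hdec using hP
  choose M hMP hM using hdec
  have hfib (f : G → Finset J) : ((Finset.univ.filter fun σ : J → κ =>
      (fun p => M p σ) = f).card : ℝ) ≤ k ^ n * Real.exp (-(θ * n)) := by
    -- These are the pairs (letter, colour) that the recipes `f` still allow at the site `s`; `H s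
    -- j` below is the best value among them.
    let A : J → κ → ι → Prop := fun s j i =>
      ∀ p : G, (j, i) ≠ (dec p (f p) s, p.1 (dec p (f p) s))
    have hH (s : J) (j : κ) : ∃ x : ℝ, |x| ≤ B ∧ (∀ i, A s j i → v j i - a j ≤ x) ∧
        (x = -B ∨ ∃ i, A s j i ∧ x = v j i - a j) := by
      by_cases hA : ∃ i, A s j i
      · obtain ⟨i, hi, hmax⟩ := (Finset.univ.filter (A s j)).exists_max_image
          (fun i => v j i - a j) (by obtain ⟨i, hi⟩ := hA; exact ⟨i, by simpa using hi⟩)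
        exact ⟨v j i - a j, (hC j i).trans hCB, fun i' hi' => hmax i' (by simpa using hi'),
          Or.inr ⟨i, by simpa using hi, rfl⟩⟩
      · exact ⟨-B, by rw [abs_neg, abs_of_pos hB0], fun i hi => (hA ⟨i, hi⟩).elim, Or.inl rfl⟩
    choose H hHB hHmax hHatt using hH
    have hHC (s : J) (j : κ) : H s j ≤ C := by
      rcases hHatt s j with h | ⟨i, -, h⟩
      · rw [h]; linarith
      · rw [h]; exact (le_abs_self _).trans (hC j i)
    have hsum (s : J) : ∑ j, H s j ≤ -ε := by
      by_cases h : ∃ j, H s j = -B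
      · obtain ⟨j, hj⟩ := h
        rw [← Finset.add_sum_erase _ _ (Finset.mem_univ j), hj]
        have h1 : ∑ j' ∈ Finset.univ.erase j, H s j' ≤ ∑ j' : κ, C :=
          (Finset.sum_le_sum fun j' _ => hHC s j').trans
            (Finset.sum_le_sum_of_subset_of_nonneg (Finset.subset_univ _) fun _ _ _ => hC0)
        rw [Finset.sum_const, Finset.card_univ, nsmul_eq_mul] at h1
        linarith
      · push Not at h
        choose p hpA hp using fun j => (hHatt s j).resolve_left (h j)
        -- Otherwise the maximising colours form a good pattern, whose own recipe forbids one of its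
        -- pairs at `s`.
        by_contra! hlt
        have hgood : ∑ j, a j - ε ≤ ∑ j, v j (p j) := by
          simp_rw [hp, Finset.sum_sub_distrib] at hlt
          linarith
        exact hpA (dec ⟨p, hgood⟩ (f ⟨p, hgood⟩) s) ⟨p, hgood⟩ rfl
    refine le_trans ?_ (card_filter_le_sum_le hHB hsum hl hlB hlε)
    refine Nat.cast_le.2 (Finset.card_le_card fun σ hσ => ?_)
    have hσf := (Finset.mem_filter.1 hσ).2
    refine Finset.mem_filter.2 ⟨Finset.mem_univ σ, (hτ σ).trans ?_⟩
    refine Finset.sum_le_sum fun s _ => hHmax s (σ s) _ fun p => ?_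
    rw [← hσf]
    exact hM p σ s
  have hcount : k ^ n ≤ Real.exp (θ / (Fintype.card G + 1) * n) ^ Fintype.card G *
      (k ^ n * Real.exp (-(θ * n))) := by
    have h1 := Finset.card_eq_sum_card_fiberwise (s := (Finset.univ : Finset (J → κ)))
      (t := Fintype.piFinset P) (f := fun σ p => M p σ)
      (fun σ _ => Finset.mem_coe.2 (Fintype.mem_piFinset.2 fun p => hMP p σ))
    have h2 : k ^ n = ((Finset.univ : Finset (J → κ)).card : ℝ) := by simp [k, n]
    rw [h1, Nat.cast_sum] at h2
    refine h2.le.trans ((Finset.sum_le_card_nsmul _ _ _ fun f _ => hfib f).trans ?_)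
    rw [nsmul_eq_mul, Fintype.card_piFinset, Nat.cast_prod]
    gcongr
    refine (Finset.prod_le_prod (fun _ _ => by positivity) fun p _ => hPc p).trans ?_
    simp
  have hlt : Real.exp (θ / (Fintype.card G + 1) * n) ^ Fintype.card G *
      Real.exp (-(θ * n)) < 1 := by
    rw [← Real.exp_nat_mul, ← Real.exp_add, Real.exp_lt_one_iff]
    have hnr : (0 : ℝ) < n := by exact_mod_cast hn
    have : (Fintype.card G : ℝ) * (θ / (Fintype.card G + 1)) < θ := by
      rw [mul_div_assoc', div_lt_iff₀ (by positivity)]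
      nlinarith
    nlinarith
  have hkn : 0 < k ^ n := by positivity
  nlinarith

/-- If for every word `σ` in `κ` there is a word `τ σ` in `ι` such that `∑ v (σ s) (τ σ s)` is
almost `∑ a (σ s)`, then some pattern `p : κ → ι` for which `∑ v j (p j)` is almost `∑ a j`
occurs freely in the words `τ σ` on a set of positive density. -/
theorem exists_pattern {κ ι : Type*} [Fintype κ] [Nonempty κ] [Fintype ι]
    (v : κ → ι → ℝ) (a : κ → ℝ) {ε : ℝ} (hε : 0 < ε) :
    ∃ c : ℝ, 0 < c ∧ ∀ (J : Type*) [Fintype J] [Nonempty J]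
      (τ : (J → κ) → J → ι),
      (∀ σ, -(ε / (4 * Fintype.card κ) * Fintype.card J) ≤ ∑ s, (v (σ s) (τ σ s) - a (σ s))) →
      ∃ p : κ → ι, ∑ j, a j - ε ≤ ∑ j, v j (p j) ∧
        ∃ I : Finset J, c * Fintype.card J ≤ I.card ∧
          ∀ σ : J → κ, ∃ σ', ∀ s ∈ I, τ σ' s = p (σ s) := by
  -- Doubling the alphabet covers the case of a single letter. Doubling `ε` as well leaves the
  -- hypothesis on `τ` unchanged, and the better copy of each letter loses at most half of `2 * ε`.
  obtain ⟨c, hc, h⟩ := exists_pattern_of_nontrivial (κ := κ × Bool)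
    (fun j => v j.1) (fun j => a j.1) (ε := 2 * ε) (by positivity)
  refine ⟨c, hc, fun J _ _ τ hτ => ?_⟩
  have e : 2 * ε / (4 * Fintype.card (κ × Bool)) = ε / (4 * Fintype.card κ) := by
    rw [Fintype.card_prod, Fintype.card_bool]
    push_cast
    field_simp
  obtain ⟨p, hp, I, hI, hsh⟩ := h J (fun σ => τ fun s => (σ s).1) fun σ => by
    rw [e]
    exact hτ fun s => (σ s).1
  have hβ (j : κ) : ∃ β, v j (p (j, true)) + v j (p (j, false)) ≤ 2 * v j (p (j, β)) := by
    rcases le_total (v j (p (j, true))) (v j (p (j, false))) with h | h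
    · exact ⟨false, by linarith⟩
    · exact ⟨true, by linarith⟩
  choose β hβ using hβ
  refine ⟨fun j => p (j, β j), ?_, I, hI, fun σ => ?_⟩
  · have := Finset.sum_le_sum fun j (_ : j ∈ Finset.univ) => hβ j
    rw [← Finset.mul_sum] at this
    simp only [Fintype.sum_prod_type, Fintype.sum_bool, Finset.sum_add_distrib] at hp this
    linarith
  · obtain ⟨σ', hσ'⟩ := hsh fun s => (σ s, β (σ s))
    exact ⟨fun s => (σ' s).1, hσ'⟩

end Patterns

/-! ### Positive upper limits along invariant sets -/

section InvariantFilter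

open scoped Pointwise symmDiff

variable {Γ : Type*} [Group Γ]

/-- Since `F.card ≤ (K₁ * F).card`, the part of `F` outside `K₁ * F` is no larger than the part of
`K₁ * F` outside `F`, and only the latter is monotone in `K`. This costs the factor 2. -/
theorem IsInvariant.mono {K₁ K₂ F : Finset Γ} {ε₁ ε₂ : ℝ} (hK₁ : K₁.Nonempty) (hK : K₁ ⊆ K₂)
    (hε : 2 * ε₂ ≤ ε₁) (h : IsInvariant K₂ ε₂ F) : IsInvariant K₁ ε₁ F := by
  classical
  obtain ⟨hF, h⟩ := h
  refine ⟨hF, ?_⟩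
  have h1 : (F \ (K₁ * F)).card ≤ ((K₁ * F) \ F).card :=
    Finset.card_sdiff_le_card_sdiff_iff.2 (Finset.card_le_card_mul_left hK₁)
  have h2 : ((K₁ * F) \ F).card ≤ ((K₂ * F) ∆ F).card :=
    Finset.card_le_card ((Finset.sdiff_subset_sdiff (Finset.mul_subset_mul_right hK)
      subset_rfl).trans Finset.subset_union_left)
  have h3 : ((K₁ * F) ∆ F).card ≤ ((K₁ * F) \ F).card + (F \ (K₁ * F)).card :=
    Finset.card_union_le _ _
  have h4 : (((K₁ * F) ∆ F).card : ℝ) ≤ 2 * ((K₂ * F) ∆ F).card := by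
    exact_mod_cast (by omega : ((K₁ * F) ∆ F).card ≤ 2 * ((K₂ * F) ∆ F).card)
  have hF' : (0 : ℝ) ≤ F.card := Nat.cast_nonneg _
  have h' : (((K₂ * F) ∆ F).card : ℝ) < ε₂ * F.card := by convert h
  have : (((K₁ * F) ∆ F).card : ℝ) < ε₁ * F.card := by nlinarith
  convert this

variable (Γ) in
/-- The filter of finite sets becoming more and more left invariant. -/
def invariantFilter : Filter (Finset Γ) where
  sets := {S | ∃ K : Finset Γ, K.Nonempty ∧ ∃ ε : ℝ, 0 < ε ∧ ∀ F, IsInvariant K ε F → F ∈ S}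
  univ_sets := ⟨{1}, Finset.singleton_nonempty 1, 1, one_pos, fun _ _ => Set.mem_univ _⟩
  sets_of_superset := by
    rintro S T ⟨K, hK, ε, hε, h⟩ hST
    exact ⟨K, hK, ε, hε, fun F hF => hST (h F hF)⟩
  inter_sets := by
    classical
    rintro S T ⟨K₁, hK₁, ε₁, hε₁, h₁⟩ ⟨K₂, hK₂, ε₂, hε₂, h₂⟩
    refine ⟨K₁ ∪ K₂, hK₁.mono Finset.subset_union_left, min ε₁ ε₂ / 2, by positivity,
      fun F hF => ⟨h₁ F (hF.mono hK₁ Finset.subset_union_left ?_),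
        h₂ F (hF.mono hK₂ Finset.subset_union_right ?_)⟩⟩
    · rw [mul_div_cancel₀ _ two_ne_zero]
      exact min_le_left _ _
    · rw [mul_div_cancel₀ _ two_ne_zero]
      exact min_le_right _ _

theorem eventually_invariantFilter {p : Finset Γ → Prop} :
    (∀ᶠ F in invariantFilter Γ, p F) ↔
      ∃ K : Finset Γ, K.Nonempty ∧ ∃ ε : ℝ, 0 < ε ∧ ∀ F, IsInvariant K ε F → p F :=
  Iff.rfl

theorem eventually_nonempty : ∀ᶠ F in invariantFilter Γ, F.Nonempty :=
  eventually_invariantFilter.2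
    ⟨{1}, Finset.singleton_nonempty 1, 1, one_pos, fun _ h => h.1⟩

theorem limsupInvariant_eq (φ : Finset Γ → ℝ) : limsupInvariant φ =
    sInf {t : ℝ | ∀ δ : ℝ, 0 < δ → ∀ᶠ F in invariantFilter Γ, φ F < t + δ} :=
  rfl

theorem limsupInvariant_le_one {φ : Finset Γ → ℝ} (hφ : ∀ F, φ F ≤ 1) :
    limsupInvariant φ ≤ 1 := by
  rw [limsupInvariant_eq]
  by_cases h : BddBelow {t : ℝ | ∀ δ : ℝ, 0 < δ → ∀ᶠ F in invariantFilter Γ, φ F < t + δ}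
  · exact csInf_le h fun δ hδ => .of_forall fun F => by linarith [hφ F]
  · rw [Real.sInf_of_not_bddBelow h]
    exact zero_le_one

/-- The set of upper bounds may be unbounded below; its real `sInf` is then the default value 0,
which agrees with the absence of a positive frequent lower bound. -/
theorem limsupInvariant_pos_iff {φ : Finset Γ → ℝ} (hφ : ∀ F, φ F ≤ 1) :
    0 < limsupInvariant φ ↔ ∃ c : ℝ, 0 < c ∧ ∃ᶠ F in invariantFilter Γ, c ≤ φ F := by
  rw [limsupInvariant_eq]
  constructor
  · intro h
    by_contra! hc
    by_cases hb : BddBelow {t : ℝ | ∀ δ : ℝ, 0 < δ → ∀ᶠ F in invariantFilter Γ, φ F < t + δ}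
    · refine h.not_ge (csInf_le hb fun δ hδ => ?_)
      simpa [Filter.not_frequently] using hc δ hδ
    · rw [Real.sInf_of_not_bddBelow hb] at h
      exact lt_irrefl _ h
  · rintro ⟨c, hc, h⟩
    refine hc.trans_le (le_csInf ⟨1, fun δ hδ => .of_forall fun F => by linarith [hφ F]⟩
      fun t ht => ?_)
    by_contra! htc
    obtain ⟨F, hF, hF'⟩ := (h.and_eventually (ht (c - t) (by linarith))).exists
    linarith

end InvariantFilter

/-! ### Positive independence density as a frequent event -/

section Density

variable {Γ X : Type*} [Group Γ] [MulAction Γ X] {k : ℕ}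

theorem IsIndependenceSet.mono {A A' : Fin k → Set X} {D D' : Set X} {J : Finset Γ}
    (hA : ∀ j, A j ⊆ A' j) (hD : D ⊆ D') (h : IsIndependenceSet A D J) :
    IsIndependenceSet A' D' J := fun σ =>
  (h σ).mono (Set.inter_subset_inter hD (Set.iInter_mono fun _ => Set.preimage_mono (hA _)))

theorem maxIndependent_le_card (A : Fin k → Set X) (D : Set X) (F : Finset Γ) :
    maxIndependent A D F ≤ F.card := by
  classical
  rw [maxIndependent]
  refine Finset.sup_le fun J hJ => ?_
  exact Finset.card_le_card (Finset.mem_powerset.1 (Finset.mem_filter.1 hJ).1)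

variable [MeasurableSpace X]

theorem minMaxIndependent_le_card (A : Fin k → Set X) (μ : ProbabilityMeasure X) {δ : ℝ}
    (hδ : 0 < δ) (F : Finset Γ) : minMaxIndependent A μ δ F ≤ F.card := by
  rw [minMaxIndependent]
  refine (Nat.sInf_le ?_).trans (maxIndependent_le_card A Set.univ F)
  exact ⟨Set.univ, .univ, by simp [hδ.le], rfl⟩

theorem le_minMaxIndependent_iff {A : Fin k → Set X} {μ : ProbabilityMeasure X} {δ x : ℝ}
    (hδ : 0 < δ) (hx : 0 < x) {F : Finset Γ} :
    x ≤ minMaxIndependent A μ δ F ↔ ∀ D : Set X, MeasurableSet D →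
      1 - δ ≤ (μ : Measure X).real D →
        ∃ J ⊆ F, IsIndependenceSet A D J ∧ x ≤ J.card := by
  classical
  constructor
  · intro h D hD hμD
    have hle : x ≤ maxIndependent A D F :=
      h.trans (Nat.cast_le.2 (Nat.sInf_le ⟨D, hD, hμD, rfl⟩))
    rcases (F.powerset.filter fun J => IsIndependenceSet A D J).eq_empty_or_nonempty with h0 | h0
    · have : maxIndependent A D F = 0 := by
        rw [maxIndependent, h0, Finset.sup_empty]
        rfl
      rw [this, Nat.cast_zero] at hle
      linarith
    · obtain ⟨J, hJ, hJs⟩ := Finset.exists_mem_eq_sup _ h0 Finset.card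
      obtain ⟨hJF, hJi⟩ := Finset.mem_filter.1 hJ
      refine ⟨J, Finset.mem_powerset.1 hJF, hJi, ?_⟩
      rwa [← hJs]
  · intro h
    obtain ⟨D, hD, hμD, hn⟩ := Nat.sInf_mem (s := {n : ℕ | ∃ D : Set X, MeasurableSet D ∧
      1 - δ ≤ (μ : Measure X).real D ∧ maxIndependent A D F = n})
      ⟨_, Set.univ, .univ, by simp [hδ.le], rfl⟩
    obtain ⟨J, hJF, hJ, hxJ⟩ := h D hD hμD
    refine hxJ.trans (Nat.cast_le.2 ?_)
    change J.card ≤ sInf _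
    rw [← hn]
    exact Finset.le_sup (f := Finset.card)
      (Finset.mem_filter.2 ⟨Finset.mem_powerset.2 hJF, hJ⟩)

/-- This is the form used throughout: minimum, maximum, upper limit and supremum unfold into
quantifiers, the bound by 1 excluding default values of the supremum. -/
theorem upperIndDensity_pos_iff {A : Fin k → Set X} {μ : ProbabilityMeasure X} :
    0 < upperIndDensity Γ A μ ↔ ∃ δ : ℝ, 0 < δ ∧ ∃ c : ℝ, 0 < c ∧
      ∃ᶠ F in invariantFilter Γ, ∀ D : Set X, MeasurableSet D → 1 - δ ≤ (μ : Measure X).real D →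
        ∃ J ⊆ F, IsIndependenceSet A D J ∧ c * F.card ≤ J.card := by
  have hle {δ : ℝ} (hδ : 0 < δ) (F : Finset Γ) :
      (minMaxIndependent A μ δ F : ℝ) / F.card ≤ 1 :=
    div_le_one_of_le₀ (Nat.cast_le.2 (minMaxIndependent_le_card A μ hδ F)) (Nat.cast_nonneg _)
  have hiff {δ : ℝ} (hδ : 0 < δ) : 0 < upperIndDensityAt Γ A μ δ ↔ ∃ c : ℝ, 0 < c ∧
      ∃ᶠ F in invariantFilter Γ, ∀ D : Set X, MeasurableSet D → 1 - δ ≤ (μ : Measure X).real D →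
        ∃ J ⊆ F, IsIndependenceSet A D J ∧ c * F.card ≤ J.card := by
    rw [upperIndDensityAt, limsupInvariant_pos_iff (hle hδ)]
    refine exists_congr fun c => and_congr_right fun hc =>
      Filter.frequently_congr (eventually_nonempty.mono fun F hF => ?_)
    have hF' : (0 : ℝ) < F.card := Nat.cast_pos.2 hF.card_pos
    rw [le_div_iff₀ hF', le_minMaxIndependent_iff hδ (mul_pos hc hF')]
  constructor
  · intro h
    by_contra hcon
    refine h.not_ge (Real.iSup_nonpos fun δ => le_of_not_gt fun hδ => ?_)
    obtain ⟨c, hc, hF⟩ := (hiff δ.2).1 hδ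
    exact hcon ⟨δ, δ.2, c, hc, hF⟩
  · rintro ⟨δ, hδ, h⟩
    refine ((hiff hδ).2 h).trans_le (le_ciSup (f := fun δ : {δ : ℝ // 0 < δ} =>
      upperIndDensityAt Γ A μ δ) ⟨1, ?_⟩ ⟨δ, hδ⟩)
    rintro _ ⟨δ', rfl⟩
    exact limsupInvariant_le_one (hle δ'.2)

theorem upperIndDensity_pos_mono {A A' : Fin k → Set X} {μ : ProbabilityMeasure X}
    (hA : ∀ j, A j ⊆ A' j) (h : 0 < upperIndDensity Γ A μ) : 0 < upperIndDensity Γ A' μ := by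
  rw [upperIndDensity_pos_iff] at h ⊢
  obtain ⟨δ, hδ, c, hc, h⟩ := h
  refine ⟨δ, hδ, c, hc, h.mono fun F hF D hD hμD => ?_⟩
  obtain ⟨J, hJF, hJ, hcJ⟩ := hF D hD hμD
  exact ⟨J, hJF, hJ.mono hA subset_rfl, hcJ⟩

end Density

/-! ### Barycenters as averages of measures -/

section Barycenter

variable {X : Type*} [TopologicalSpace X]

/-- Evaluation at `f` as a weak* continuous linear functional. -/
noncomputable def evalDual (f : C(X, ℝ)) : WeakDual ℝ C(X, ℝ) →L[ℝ] ℝ :=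
  WeakBilin.eval (topDualPairing ℝ C(X, ℝ)) f

theorem exists_eq_evalDual (φ : WeakDual ℝ C(X, ℝ) →L[ℝ] ℝ) : ∃ f, evalDual f = φ :=
  LinearMap.dualEmbedding_surjective (topDualPairing ℝ C(X, ℝ)) φ

variable [CompactSpace X] [MeasurableSpace X] [BorelSpace X]

theorem evalDual_toDual (f : C(X, ℝ)) (μ : ProbabilityMeasure X) :
    evalDual f (toDual μ) = ∫ x, f x ∂(μ : Measure X) :=
  rfl

theorem continuousMap_integrable (f : C(X, ℝ)) (μ : ProbabilityMeasure X) :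
    Integrable f (μ : Measure X) :=
  f.continuous.integrable_of_hasCompactSupport (HasCompactSupport.of_compactSpace _)

theorem continuous_integral (f : C(X, ℝ)) :
    Continuous fun ν : ProbabilityMeasure X => ∫ x, f x ∂(ν : Measure X) :=
  ProbabilityMeasure.continuous_integral_boundedContinuousFunction
    (BoundedContinuousFunction.mkOfCompact f)

variable [TopologicalSpace.MetrizableSpace X]

/-- The barycenter and the mixture of the `ν` under `m` have the same integrals of continuous
functions, as evaluations at these are continuous functionals; hence they agree as measures. -/
theorem IsBarycenter.lintegral_measure_eq {m : ProbabilityMeasure (ProbabilityMeasure X)}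
    {μ : ProbabilityMeasure X} (h : IsBarycenter m μ) {D : Set X} (hD : MeasurableSet D) :
    ∫⁻ ν, (ν : Measure X) D ∂(m : Measure (ProbabilityMeasure X)) = (μ : Measure X) D := by
  have := TopologicalSpace.pseudoMetrizableSpacePseudoMetric X
  have hcoe : Measurable fun ν : ProbabilityMeasure X => (ν : Measure X) := measurable_subtype_coe
  have key : (μ : Measure X) = (Measure.map (fun ν : ProbabilityMeasure X => (ν : Measure X))
      (m : Measure (ProbabilityMeasure X))).join := by
    refine ext_of_forall_lintegral_eq_of_IsFiniteMeasure fun f => ?_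
    have hf : Measurable fun x => (f x : ENNReal) :=
      f.continuous.measurable.coe_nnreal_ennreal
    rw [Measure.lintegral_join hf.aemeasurable,
      lintegral_map (Measure.measurable_lintegral hf) hcoe]
    let g : C(X, ℝ) := ⟨fun x => f x, NNReal.continuous_coe.comp f.continuous⟩
    have hg (ν : ProbabilityMeasure X) :
        ∫⁻ x, (f x : ENNReal) ∂(ν : Measure X) = ENNReal.ofReal (∫ x, g x ∂(ν : Measure X)) := by
      rw [ofReal_integral_eq_lintegral_ofReal (continuousMap_integrable g ν)
        (.of_forall fun x => (f x).2)]
      exact lintegral_congr fun x => ENNReal.ofReal_coe_nnreal.symm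
    simp_rw [hg]
    rw [← ofReal_integral_eq_lintegral_ofReal
      ((continuous_integral g).integrable_of_hasCompactSupport
        (HasCompactSupport.of_compactSpace _))
      (.of_forall fun ν => integral_nonneg fun x => (f x).2)]
    exact congrArg ENNReal.ofReal (h (evalDual g)).symm
  rw [key, Measure.join_apply hD, lintegral_map (Measure.measurable_coe hD) hcoe]

/-- Markov's inequality for the measures of a fixed set. -/
theorem IsBarycenter.measureReal_le {m : ProbabilityMeasure (ProbabilityMeasure X)}
    {μ : ProbabilityMeasure X} (h : IsBarycenter m μ) {D : Set X} (hD : MeasurableSet D)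
    {δ η : ℝ} (hη : 0 < η) (hμ : (μ : Measure X).real Dᶜ ≤ δ * η) :
    1 - δ ≤ (m : Measure (ProbabilityMeasure X)).real
      {ν | 1 - η ≤ (ν : Measure X).real D} := by
  have hcoe : Measurable fun ν : ProbabilityMeasure X => (ν : Measure X) := measurable_subtype_coe
  have hmeas : MeasurableSet {ν : ProbabilityMeasure X | 1 - η ≤ (ν : Measure X).real D} :=
    measurableSet_le measurable_const
      (((Measure.measurable_coe hD).comp hcoe).ennreal_toReal)
  have hsub : {ν : ProbabilityMeasure X | 1 - η ≤ (ν : Measure X).real D}ᶜ ⊆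
      {ν | ENNReal.ofReal η ≤ (ν : Measure X) Dᶜ} := by
    intro ν hν
    simp only [Set.mem_compl_iff, Set.mem_ofPred_eq, not_le] at hν
    refine (ENNReal.ofReal_le_iff_le_toReal (measure_ne_top _ _)).2 ?_
    change η ≤ (ν : Measure X).real Dᶜ
    rw [probReal_compl_eq_one_sub hD]
    linarith
  have hmarkov := mul_meas_ge_le_lintegral₀ (μ := (m : Measure (ProbabilityMeasure X)))
    ((Measure.measurable_coe hD.compl).comp hcoe).aemeasurable (ENNReal.ofReal η)
  simp only [Function.comp_apply] at hmarkov
  rw [h.lintegral_measure_eq hD.compl] at hmarkov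
  have h1 := ENNReal.toReal_mono (measure_ne_top _ _) hmarkov
  rw [ENNReal.toReal_mul, ENNReal.toReal_ofReal hη.le] at h1
  have h2 : η * (m : Measure (ProbabilityMeasure X)).real
      {ν : ProbabilityMeasure X | 1 - η ≤ (ν : Measure X).real D}ᶜ ≤ δ * η :=
    (mul_le_mul_of_nonneg_left (measureReal_mono hsub) hη.le).trans (h1.trans hμ)
  rw [probReal_compl_eq_one_sub hmeas, mul_comm δ η] at h2
  linarith [le_of_mul_le_mul_left h2 hη]

end Barycenter

/-! ### From independence of measures to independence of points -/

/-- A function bounded above with large integral is large somewhere on a set of almost full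
measure. -/
theorem exists_mem_le_of_lt_integral {X : Type*} [MeasurableSpace X] {ν : Measure X}
    [IsProbabilityMeasure ν] {g : X → ℝ} (hg : Integrable g ν) {D : Set X} (hD : MeasurableSet D)
    {C t η : ℝ} (hC : ∀ x, g x ≤ C) (htC : t ≤ C) (hη : 1 - η ≤ ν.real D)
    (h : t + (C - t) * η < ∫ x, g x ∂ν) : ∃ x ∈ D, t ≤ g x := by
  by_contra! hcon
  have hint : Integrable (fun x => t + (Dᶜ).indicator (fun _ => C - t) x) ν :=
    (integrable_const t).add ((integrable_const _).indicator hD.compl)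
  have hle : ∫ x, g x ∂ν ≤ ∫ x, t + (Dᶜ).indicator (fun _ => C - t) x ∂ν := by
    refine integral_mono hg hint fun x => ?_
    by_cases hx : x ∈ D
    · simpa [hx] using (hcon x hx).le
    · simpa [hx] using hC x
  rw [integral_add (integrable_const t) ((integrable_const _).indicator hD.compl),
    integral_indicator_const _ hD.compl, probReal_compl_eq_one_sub hD] at hle
  simp only [integral_const, probReal_univ, smul_eq_mul, one_mul] at hle
  nlinarith

variable {Γ X : Type*} [Group Γ] [TopologicalSpace X] [MeasurableSpace X] [BorelSpace X]
  [MulAction Γ X] [ContinuousConstSMul Γ X]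

theorem integral_smul_measure_eq (s : Γ) (ν : ProbabilityMeasure X) (f : C(X, ℝ)) :
    ∫ x, f x ∂((s • ν : ProbabilityMeasure X) : Measure X) = ∫ x, f (s • x) ∂(ν : Measure X) :=
  integral_map (measurable_const_smul s).aemeasurable f.continuous.measurable.aestronglyMeasurable

variable [CompactSpace X] [TopologicalSpace.MetrizableSpace X] {k : ℕ}

/-- An independence set for half-spaces of measures relative to the measures almost carried by `D`
yields, for every choice of half-spaces, a point of `D` whose orbit satisfies the inequalities on
average. -/
theorem exists_mem_le_sum {f : Fin k → C(X, ℝ)} {a : Fin k → ℝ} {C e η : ℝ}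
    (hC : ∀ j x, f j x - a j ≤ C) (hC0 : 0 < C) (he : 0 < e) (hη2 : η ≤ 1 / 2) (hηC : C * η ≤ e)
    {D : Set X} (hD : MeasurableSet D) {J : Finset Γ} (hJ0 : J.Nonempty)
    (hJ : IsIndependenceSet
      (fun j => {ν : ProbabilityMeasure X | a j - e < ∫ x, f j x ∂(ν : Measure X)})
      {ν : ProbabilityMeasure X | 1 - η ≤ (ν : Measure X).real D} J) (σ : J → Fin k) :
    ∃ x ∈ D, -(4 * e * J.card) ≤ ∑ s : J, (f (σ s) ((s : Γ) • x) - a (σ s)) := by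
  obtain ⟨ν, hνD, hν⟩ := hJ σ
  rw [Set.mem_iInter] at hν
  have hn : (0 : ℝ) < J.card := Nat.cast_pos.2 hJ0.card_pos
  have hfi (s : J) : Integrable (fun x => f (σ s) ((s : Γ) • x)) (ν : Measure X) :=
    continuousMap_integrable
      ⟨fun x => f (σ s) ((s : Γ) • x), (f (σ s)).continuous.comp (continuous_const_smul _)⟩ ν
  have hint (s : J) : Integrable (fun x => f (σ s) ((s : Γ) • x) - a (σ s)) (ν : Measure X) :=
    (hfi s).sub (integrable_const _)
  refine exists_mem_le_of_lt_integral (C := C * J.card) (η := η)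
    (integrable_finsetSum _ fun s _ => hint s) hD ?_ ?_ hνD ?_
  · intro x
    refine (Finset.sum_le_card_nsmul _ _ C fun s _ => hC (σ s) _).trans_eq ?_
    simp [mul_comm]
  · nlinarith [mul_pos he hn, mul_pos hC0 hn]
  · rw [integral_finsetSum _ fun s _ => hint s]
    have hlow : ∑ _s : J, -e < ∑ s : J, ∫ x, (f (σ s) ((s : Γ) • x) - a (σ s)) ∂(ν : Measure X) := by
      refine Finset.sum_lt_sum_of_nonempty ⟨⟨_, hJ0.choose_spec⟩, Finset.mem_univ _⟩ fun s _ => ?_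
      have h : a (σ s) - e < ∫ x, f (σ s) x ∂(((s : Γ) • ν : ProbabilityMeasure X) : Measure X) :=
        hν s
      rw [integral_smul_measure_eq] at h
      rw [integral_sub (hfi s) (integrable_const _)]
      simp only [integral_const, probReal_univ, smul_eq_mul, one_mul]
      linarith
    -- With `n = J.card`, the threshold is `-4en` and the loss outside `D` is at most `(C + 4e)nη ≤
    -- en + 2en`, so their sum is at most `-en`, which lies below the integral.
    refine lt_of_le_of_lt ?_ hlow
    rw [Finset.sum_const, Finset.card_univ, Fintype.card_coe, nsmul_eq_mul]
    have h1 : C * η * J.card ≤ e * J.card := by gcongr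
    have h2 : e * J.card * η ≤ e * J.card * (1 / 2) := by gcongr
    linarith

/-- A measure IE-tuple for `m` on the space of measures forces positive density for the fibres of a
finite colouring of `X` on which the test functions are on average as large as on the tuple. -/
theorem exists_fibres_density_pos [NeZero k] {m : ProbabilityMeasure (ProbabilityMeasure X)}
    {μ : ProbabilityMeasure X} (hμ : IsBarycenter m μ) {ν : Fin k → ProbabilityMeasure X}
    (hν : ν ∈ measureIE Γ k m) (f : Fin k → C(X, ℝ)) {ι : Type*} [Fintype ι] (col : X → ι)
    (v : Fin k → ι → ℝ) {ε : ℝ} (hε : 0 < ε)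
    (hv : ∀ j x, |f j x - v j (col x)| ≤ ε / (20 * k)) :
    ∃ p : Fin k → ι, ∑ j, ∫ x, f j x ∂(ν j : Measure X) - ε ≤ ∑ j, v j (p j) ∧
      0 < upperIndDensity Γ (fun j => col ⁻¹' {p j}) μ := by
  classical
  have hk : (0 : ℝ) < k := Nat.cast_pos.2 (NeZero.pos k)
  set a : Fin k → ℝ := fun j => ∫ x, f j x ∂(ν j : Measure X)
  set e := ε / (20 * k)
  have he : 0 < e := by positivity
  obtain ⟨C, hC0, hC⟩ : ∃ C : ℝ, 0 < C ∧ ∀ j x, f j x - a j ≤ C := by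
    obtain ⟨C, hC⟩ := (Set.finite_range fun j => ‖f j‖ + |a j|).bddAbove
    refine ⟨max C 1, by positivity, fun j x => le_max_of_le_left ((?_ : _ ≤ _).trans (hC ⟨j, rfl⟩))⟩
    have h1 := (le_abs_self _).trans ((f j).norm_coe_le_norm x)
    have h2 := neg_abs_le (a j)
    linarith
  obtain ⟨c, hc, hpat⟩ := exists_pattern v a hε
  have hA := hν (fun j => {ν' | a j - e < ∫ x, f j x ∂(ν' : Measure X)}) fun j =>
    (isOpen_lt continuous_const (continuous_integral (f j))).mem_nhds (by
      change a j - e < a j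
      linarith)
  obtain ⟨δ₀, hδ₀, c₀, hc₀, hfreq⟩ := upperIndDensity_pos_iff.1 hA
  set η := min (1 / 2) (e / C)
  have hη : 0 < η := by positivity
  have hηC : C * η ≤ e := by
    rw [mul_comm]
    exact (le_div_iff₀ hC0).1 (min_le_right _ _)
  set N : ℝ := (Fintype.card (Fin k → ι) : ℝ)
  -- A bad set of measure at least `1 - δ` may occur for each of the `N` patterns; their
  -- intersection must miss mass at most `δ₀ * η` for Markov's inequality.
  set δ := δ₀ * η / (N + 1)
  have hN : 0 ≤ N := Nat.cast_nonneg _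
  have hδ : 0 < δ := by positivity
  have hNδ : N * δ ≤ δ₀ * η := by
    have : δ * (N + 1) = δ₀ * η := div_mul_cancel₀ _ (by positivity)
    linarith
  let Q : (Fin k → ι) → Finset Γ → Prop := fun p F =>
    ∑ j, a j - ε ≤ ∑ j, v j (p j) ∧ ∀ D : Set X, MeasurableSet D →
      1 - δ ≤ (μ : Measure X).real D →
        ∃ J ⊆ F, IsIndependenceSet (fun j => col ⁻¹' {p j}) D J ∧ c * c₀ * F.card ≤ J.card
  have key : ∃ᶠ F in invariantFilter Γ, ∃ p, Q p F := by
    refine (hfreq.and_eventually eventually_nonempty).mono fun F ⟨hF, hF0⟩ => ?_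
    by_contra! hcon
    -- The pattern is found only after `D` is fixed, so one set has to defeat all patterns at once:
    -- the intersection of the individual bad sets.
    have hbad (p : Fin k → ι) : ∃ D : Set X, MeasurableSet D ∧ 1 - δ ≤ (μ : Measure X).real D ∧
        (∑ j, a j - ε ≤ ∑ j, v j (p j) → ∀ J ⊆ F,
          IsIndependenceSet (fun j => col ⁻¹' {p j}) D J → ¬ c * c₀ * F.card ≤ J.card) := by
      by_cases hp : ∑ j, a j - ε ≤ ∑ j, v j (p j)
      · by_contra! h
        exact hcon p ⟨hp, fun D hD hμD => (h D hD hμD).2⟩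
      · exact ⟨Set.univ, .univ, by simp [hδ.le], fun h => (hp h).elim⟩
    choose D hD hμD hDbad using hbad
    have hDm : MeasurableSet (⋂ p, D p) := .iInter hD
    have hDc : (μ : Measure X).real (⋂ p, D p)ᶜ ≤ δ₀ * η := by
      rw [Set.compl_iInter]
      refine (measureReal_iUnion_fintype_le _).trans (le_trans ?_ hNδ)
      have := Finset.sum_le_card_nsmul (Finset.univ : Finset (Fin k → ι))
        (fun p => (μ : Measure X).real (D p)ᶜ) δ fun p _ => by
          rw [probReal_compl_eq_one_sub (hD p)]
          linarith [hμD p]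
      rwa [nsmul_eq_mul] at this
    have hmeas : MeasurableSet
        {ν : ProbabilityMeasure X | 1 - η ≤ (ν : Measure X).real (⋂ p, D p)} :=
      measurableSet_le measurable_const
        ((Measure.measurable_coe hDm).comp measurable_subtype_coe).ennreal_toReal
    obtain ⟨J, hJF, hJ, hJc⟩ := hF _ hmeas (hμ.measureReal_le hDm hη hDc)
    have hF0' : (0 : ℝ) < F.card := Nat.cast_pos.2 hF0.card_pos
    have hJ0 : J.Nonempty :=
      Finset.card_pos.1 (Nat.cast_pos.1 ((mul_pos hc₀ hF0').trans_le hJc))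
    choose x hxD hx using exists_mem_le_sum hC hC0 he (min_le_left _ _) hηC hDm hJ0 hJ
    have : Nonempty J := hJ0.to_subtype
    obtain ⟨p, hp, I, hI, hsh⟩ := hpat J (fun σ s => col ((s : Γ) • x σ)) fun σ => by
      have h1 : ∑ s : J, (f (σ s) ((s : Γ) • x σ) - a (σ s)) ≤
          ∑ s : J, (v (σ s) (col ((s : Γ) • x σ)) - a (σ s) + e) :=
        Finset.sum_le_sum fun s _ => by
          linarith [(abs_le.1 (hv (σ s) ((s : Γ) • x σ))).2]
      rw [Finset.sum_add_distrib, Finset.sum_const, Finset.card_univ, nsmul_eq_mul] at h1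
      have h2 := hx σ
      rw [← Fintype.card_coe] at h2
      -- The error `5 * e` splits into `4 * e` from the choice of the point and `e` from the
      -- colouring; hence the constant 20.
      have h3 : ε / (4 * (Fintype.card (Fin k) : ℝ)) = 5 * e := by
        rw [Fintype.card_fin]
        simp only [e]
        field_simp
        norm_num
      rw [h3]
      linarith
    rw [Fintype.card_coe] at hI
    refine hDbad p hp (I.map (Function.Embedding.subtype _)) ?_ ?_ ?_
    · intro s hs
      obtain ⟨t, -, rfl⟩ := Finset.mem_map.1 hs
      exact hJF t.2
    · intro q
      -- The value 0 off `I` is arbitrary, as freeness concerns only the sites of `I`.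
      obtain ⟨σ', hσ'⟩ := hsh fun s =>
        if h : (s : Γ) ∈ I.map (Function.Embedding.subtype _) then q ⟨s, h⟩ else 0
      refine ⟨x σ', Set.mem_iInter.1 (hxD σ') p, Set.mem_iInter.2 fun s => ?_⟩
      obtain ⟨t, ht, hts⟩ := Finset.mem_map.1 s.2
      have h := hσ' t ht
      have hts' : (t : Γ) = s := hts
      rw [dif_pos (by rw [hts']; exact s.2)] at h
      simp only [hts'] at h
      exact h
    · rw [Finset.card_map, mul_assoc]
      exact (mul_le_mul_of_nonneg_left hJc hc.le).trans hI
  -- The pattern depends on `F`, but there are finitely many, so one of them works frequently.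
  obtain ⟨p, hp⟩ : ∃ p, ∃ᶠ F in invariantFilter Γ, Q p F := by
    by_contra h
    rw [not_exists] at h
    refine key ((Filter.eventually_all.2 fun p => Filter.not_frequently.1 (h p)).mono fun F hF => ?_)
    rintro ⟨p, hp⟩
    exact hF p hp
  obtain ⟨F, hF⟩ := hp.exists
  exact ⟨p, hF.1, upperIndDensity_pos_iff.2
    ⟨δ, hδ, c * c₀, mul_pos hc hc₀, hp.mono fun F hF => hF.2⟩⟩

/-- Every measure IE-tuple of measures is dominated, on any tuple of test functions, by a measure
IE-tuple of points. -/
theorem exists_mem_measureIE_le_sum [NeZero k] {m : ProbabilityMeasure (ProbabilityMeasure X)}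
    {μ : ProbabilityMeasure X} (hμ : IsBarycenter m μ) {ν : Fin k → ProbabilityMeasure X}
    (hν : ν ∈ measureIE Γ k m) (f : Fin k → C(X, ℝ)) {ε : ℝ} (hε : 0 < ε) :
    ∃ x ∈ measureIE Γ k μ, ∑ j, ∫ y, f j y ∂(ν j : Measure X) - ε ≤ ∑ j, f j (x j) := by
  classical
  let : MetricSpace X := TopologicalSpace.metrizableSpaceMetric X
  by_contra! hcon
  set t := ∑ j, ∫ y, f j y ∂(ν j : Measure X) - ε
  have hk : (0 : ℝ) < k := Nat.cast_pos.2 (NeZero.pos k)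
  let Z : Set (Fin k → X) := {x | t ≤ ∑ j, f j (x j)}
  have hZ : IsCompact Z :=
    (isClosed_le continuous_const (by fun_prop)).isCompact
  -- If no tuple in `Z` is an IE-tuple, open boxes without positive density cover `Z`. A colouring
  -- finer than their Lebesgue number gives fibres of positive density inside one such box, a
  -- contradiction.
  have hnull (x : Z) : ∃ U : Fin k → Set X, (∀ j, IsOpen (U j)) ∧ (∀ j, x.1 j ∈ U j) ∧
      ¬ 0 < upperIndDensity Γ U μ := by
    have hx : x.1 ∉ measureIE Γ k μ := fun h => (hcon x.1 h).not_ge x.2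
    simp only [measureIE, Set.mem_ofPred_eq, not_forall] at hx
    obtain ⟨U, hU, hUd⟩ := hx
    exact ⟨fun j => interior (U j), fun j => isOpen_interior,
      fun j => mem_interior_iff_mem_nhds.2 (hU j),
      fun h => hUd (upperIndDensity_pos_mono (fun j => interior_subset) h)⟩
  choose U hUo hUx hUd using hnull
  obtain ⟨r, hr, hball⟩ := lebesgue_number_lemma_of_metric hZ
    (c := fun x : Z => Set.univ.pi (U x)) (fun x => isOpen_set_pi Set.finite_univ fun j _ => hUo x j)
    fun x hx => Set.mem_iUnion.2 ⟨⟨x, hx⟩, fun j _ => hUx ⟨x, hx⟩ j⟩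
  have hunif (j : Fin k) : ∃ d > 0, ∀ x y : X, dist x y < d →
      dist (f j x) (f j y) < ε / (20 * k) :=
    Metric.uniformContinuous_iff.1
      (CompactSpace.uniformContinuous_of_continuous (f j).continuous) _ (by positivity)
  choose d hd hdf using hunif
  obtain ⟨r', hr', hr'd⟩ : ∃ r' > 0, r' ≤ r ∧ ∀ j, r' ≤ d j := by
    refine ⟨min r (Finset.univ.inf' Finset.univ_nonempty d), ?_, min_le_left _ _,
      fun j => (min_le_right _ _).trans (Finset.inf'_le _ (Finset.mem_univ j))⟩
    exact lt_min hr ((Finset.lt_inf'_iff _).2 fun j _ => hd j)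
  obtain ⟨T, -, hT, hcov⟩ := finite_cover_balls_of_compact (isCompact_univ (X := X)) hr'
  have : Fintype T := hT.fintype
  have hcol (x : X) : ∃ y : T, dist x y < r' := by
    obtain ⟨y, hy, hxy⟩ := Set.mem_iUnion₂.1 (hcov (Set.mem_univ x))
    exact ⟨⟨y, hy⟩, hxy⟩
  choose col hcol using hcol
  -- The colours are net points, and `v` is the value of `f` there, so the inequality for `p` says
  -- exactly that the tuple `p` lies in `Z`.
  obtain ⟨p, hp, hpd⟩ := exists_fibres_density_pos hμ hν f col (fun j y => f j y) hε
    fun j x => (hdf j x (col x) ((hcol x).trans_le (hr'd.2 j))).le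
  obtain ⟨z, hz⟩ := hball (fun j => (p j : X)) hp
  refine hUd z (upperIndDensity_pos_mono (fun j y hy => ?_) hpd)
  have hy' : dist y (p j) < r := by
    have hcy : col y = p j := hy
    rw [← hcy]
    exact (hcol y).trans_le hr'd.1
  have hmem : Function.update (fun j => (p j : X)) j y ∈ Metric.ball (fun j => (p j : X)) r := by
    rw [Metric.mem_ball, dist_pi_lt_iff hr]
    intro i
    rcases eq_or_ne i j with rfl | hij
    · rwa [Function.update_self]
    · rwa [Function.update_of_ne hij, dist_self]
  have := hz hmem j (Set.mem_univ j)
  rwa [Function.update_self] at this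

end MeasureIE

/-! ### Separation by functionals and by bump functions -/

open MeasureIE in
theorem theorem1p3 {Γ X : Type*} [Group Γ] [Countable Γ] [Infinite Γ]
    [TopologicalSpace X] [CompactSpace X] [TopologicalSpace.MetrizableSpace X]
    [MeasurableSpace X] [BorelSpace X] [MulAction Γ X] [ContinuousConstSMul Γ X]
    (hΓ : MeasureIE.IsAmenable Γ)
    (m : ProbabilityMeasure (ProbabilityMeasure X))
    (hm : SMulInvariantMeasure Γ (ProbabilityMeasure X)
      (m : Measure (ProbabilityMeasure X)))
    (μ : ProbabilityMeasure X) (hμ : MeasureIE.IsBarycenter m μ)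
    (k : ℕ) (hk : 1 ≤ k) :
    (∀ ν ∈ MeasureIE.measureIE Γ k m,
      (fun j => MeasureIE.toDual (ν j)) ∈ closedConvexHull ℝ
        ((fun (x : Fin k → X) j => MeasureIE.toDual (diracProba (x j))) ''
          MeasureIE.measureIE Γ k μ)) ∧
    (∀ x : Fin k → X, (fun j => diracProba (x j)) ∈ MeasureIE.measureIE Γ k m →
      x ∈ MeasureIE.measureIE Γ k μ) := by
  classical
  have : NeZero k := ⟨by omega⟩
  have hdirac (g : C(X, ℝ)) (y : X) : ∫ z, g z ∂(diracProba y : Measure X) = g y :=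
    integral_dirac' _ _ g.continuous.stronglyMeasurable
  constructor
  · intro ν hν
    by_contra hcon
    have : LocallyConvexSpace ℝ (WeakDual ℝ C(X, ℝ)) :=
      inferInstanceAs (LocallyConvexSpace ℝ (WeakBilin (topDualPairing ℝ C(X, ℝ))))
    obtain ⟨φ, u, hφ, hu⟩ := geometric_hahn_banach_closed_point convex_closedConvexHull
      isClosed_closedConvexHull hcon
    -- Each coordinate of the separating functional is weak* continuous, hence evaluation at a test
    -- function.
    choose f hf using fun j => exists_eq_evalDual
      (φ.comp (ContinuousLinearMap.single ℝ (fun _ : Fin k => WeakDual ℝ C(X, ℝ)) j))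
    have hφf (θ : Fin k → ProbabilityMeasure X) :
        φ (fun j => toDual (θ j)) = ∑ j, ∫ x, f j x ∂(θ j : Measure X) := by
      have h1 : (fun j => toDual (θ j)) = ∑ j, Pi.single j (toDual (θ j)) :=
        (Finset.univ_sum_single _).symm
      rw [h1, map_sum]
      refine Finset.sum_congr rfl fun j _ => ?_
      rw [← evalDual_toDual, hf]
      rfl
    obtain ⟨x, hx, hle⟩ := exists_mem_measureIE_le_sum hμ hν f (sub_pos.2 hu)
    have h1 := hφ _ (subset_closedConvexHull ⟨x, hx, rfl⟩)
    rw [hφf] at h1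
    simp only [hdirac] at h1
    rw [hφf] at hle
    linarith
  · intro x hx U hU
    have hsep (j : Fin k) : ∃ g : C(X, ℝ), g (x j) = 1 ∧ (∀ y ∉ interior (U j), g y = 0) ∧
        ∀ y, g y ≤ 1 := by
      obtain ⟨g, h0, h1, h01⟩ := exists_continuous_zero_one_of_isClosed
        (isOpen_interior (s := U j)).isClosed_compl (isClosed_singleton (x := x j))
        (Set.disjoint_singleton_right.2 fun h => h (mem_interior_iff_mem_nhds.2 (hU j)))
      exact ⟨g, h1 rfl, fun y hy => h0 hy, fun y => (h01 y).2⟩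
    choose g hg1 hg0 hgle using hsep
    -- The bumps sum to at least `k - 1 / 2` at `y`, whereas one coordinate outside its
    -- neighbourhood would cap the sum at `k - 1`. So each `U j` is a neighbourhood of `y j`.
    obtain ⟨y, hy, hle⟩ := exists_mem_measureIE_le_sum hμ hx g (ε := 1 / 2) (by norm_num)
    simp only [hdirac, hg1] at hle
    refine hy U fun j => mem_interior_iff_mem_nhds.1 ?_
    by_contra hj
    have h1 : ∑ i, g i (y i) ≤ ∑ i, if i = j then 0 else (1 : ℝ) := by
      refine Finset.sum_le_sum fun i _ => ?_
      split_ifs with h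
      · subst h
        exact (hg0 i _ hj).le
      · exact hgle i _
    have h2 : ∑ i, (if i = j then 0 else (1 : ℝ)) = ∑ _i : Fin k, (1 : ℝ) - 1 := by
      rw [← Finset.add_sum_erase _ (fun _ => (1 : ℝ)) (Finset.mem_univ j),
        ← Finset.add_sum_erase _ _ (Finset.mem_univ j), if_pos rfl,
        Finset.sum_congr rfl fun i hi => if_neg (Finset.ne_of_mem_erase hi)]
      ring
    linarith
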